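/- **Theorem (List-Decoding Direct Product Theorem).** For a set $X \subseteq \{0,1\}^N$, a finite set $O$ of outputs, and a relation $F$ assigning to each $x \in X$ a set $F(x) \subseteq O$ of correct outputs, let $\mathrm{R}_\gamma(F)$ denote the worst-case randomized query complexity of $F$ with success probability $\gamma$: the minimum of $\mathrm{cost}(R) = \max_{x \in X,\, D \in \mathrm{supp}(R)} \mathrm{cost}(D(x))$ over all randomized algorithms $R$ (probability distributions over deterministic decision trees $D$ that query bits of the input and have leaves labelled by elements of $O$) such that for every $x \in X$ the output of $R$ on $x$ is in $F(x)$ with probability at least $\gamma$; here $\mathrm{cost}(D(x))$ is the number of bits that $D$ queries on $x$. For a function $f$, $\mathrm{R}_\gamma(f)$ is obtained from $F(x)=\{f(x)\}$, and $\mathrm{R}(f) = \mathrm{R}_{2/3}(f)$. There exist universal constants $c \in (\frac12, 1)$ and $\kappa > 0$ such that for every $m$, every (possibly partial) function $f \colon X \to \{0,1\}$ with $X \subseteq \{0,1\}^m$, every $n \ge 1$, every $\ell \in \{1,2,\ldots,n\}$ and every $\gamma \in [c,1)$, $$\mathrm{R}_{\gamma^\ell}\left(\mathrm{LD}^n_\ell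 \circ f\right) \ \ge\ \kappa \cdot \ell \cdot \mathrm{R}(f),$$ where $\mathrm{LD}^n_\ell \circ f$ is the relation with domain $X^n \subseteq \{0,1\}^{m \times n}$ whose correct outputs on $x = (x^{(1)},\ldots,x^{(n)})$ are the sets $S \subseteq \{0,1\}^n$ with $|S| = 2^{n-\ell}$ and $\big(f(x^{(1)}),\ldots,f(x^{(n)})\big) \in S$. -/

import Mathlib

open scoped ENNReal

/-- Deterministic decision trees that query Boolean variables indexed by `ι` and output elements
of `O`. In `query i t₀ t₁` the variable `i` is queried and the computation continues with `t₀` if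
the answer is `0` and with `t₁` if it is `1`. -/
inductive DecisionTree (ι O : Type) : Type
  | leaf (o : O) : DecisionTree ι O
  | query (i : ι) (t₀ t₁ : DecisionTree ι O) : DecisionTree ι O

namespace DecisionTree

variable {ι O : Type}

/-- The label of the leaf reached on input `x`. -/
def output : DecisionTree ι O → (ι → Bool) → O
  | leaf o, _ => o
  | query i t₀ t₁, x => if x i then t₁.output x else t₀.output x

/-- The depth of the leaf reached on input `x`: the number of queries made on `x`. -/
def cost : DecisionTree ι O → (ι → Bool) → ℕ
  | leaf _, _ => 0
  | query i t₀ t₁, x => (if x i then t₁.cost x else t₀.cost x) + 1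

end DecisionTree

/-- A randomized query algorithm is a probability distribution over decision trees. -/
abbrev RandAlg (ι O : Type) : Type := PMF (DecisionTree ι O)

namespace RandAlg

variable {ι O : Type}

/-- The probability, over the internal randomness of `R`, that the output of `R` on input `x`
lies in the set `S`. -/
noncomputable def prob (R : RandAlg ι O) (x : ι → Bool) (S : Set O) : ℝ≥0∞ :=
  R.toOuterMeasure {D | D.output x ∈ S}

/-- The absolute worst-case cost of `R` on the domain `X`: the maximum number of queries over the
inputs in `X` and over the decision trees in the support of `R`. -/
noncomputable def worstCost (R : RandAlg ι O) (X : Set (ι → Bool)) : ℕ∞ :=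
  ⨆ D ∈ R.support, ⨆ x ∈ X, (D.cost x : ℕ∞)

end RandAlg

/-- The worst-case randomized query complexity of the relation `F` with domain `X`
(`F x` is the set of correct outputs on input `x`) for the success probability `γ`:
the minimum worst-case cost of a randomized algorithm that
on every input in `X` gives a correct output with probability at least `γ`. -/
noncomputable def randQueryComplexity {ι O : Type} {X : Set (ι → Bool)} (γ : ℝ)
    (F : X → Set O) : ℕ∞ :=
  ⨅ (R : RandAlg ι O) (_ : ∀ x : X, ENNReal.ofReal γ ≤ R.prob x (F x)), R.worstCost X

/-- A (partial) function viewed as the relation whose only correct output is its value. -/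
def functionRel {A O : Type} (f : A → O) : A → Set O := fun x => {f x}

/-- The domain `X ^ n` of the `n`-fold direct product of a partial function with domain `X`;
bit `j` of the `i`-th instance has index `(i, j)`. -/
def powDomain {m : ℕ} (X : Set (Fin m → Bool)) (n : ℕ) : Set (Fin n × Fin m → Bool) :=
  {x | ∀ i : Fin n, (fun j => x (i, j)) ∈ X}

/-- The `n`-fold direct product of a partial Boolean function `f` with domain `X`. -/
def directProduct {m : ℕ} {X : Set (Fin m → Bool)} (f : X → Bool) (n : ℕ) :
    powDomain X n → (Fin n → Bool) :=
  fun x i => f ⟨fun j => x.1 (i, j), x.2 i⟩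

/-- The list-decoding relation: the correct outputs on `y ∈ {0,1}ⁿ` are the
lists of exactly `2 ^ (n - ℓ)` strings that contain `y` (it is used for `ℓ ≤ n`). -/
def listDecoding (n ℓ : ℕ) (y : Fin n → Bool) : Set (Finset (Fin n → Bool)) :=
  {S | S.card = 2 ^ (n - ℓ) ∧ y ∈ S}

/-! Let `r` be a positive integer with r ≤ R(f), and charge λ = 81 / r per query in a game where a
tree predicts f by a real number t and is paid `score`. By minimax, either some mixture of trees has
positive net payoff on every input, or some distribution μ leaves no tree a positive expected
payoff. The first is impossible: a sequential test on independent samples of the mixture would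
compute f with error at most 1/3 in fewer than `r` queries (`randQueryComplexity_le_of_score`).

Start from μⁿ. Conditioning on answers keeps the weights in product form. The product over the
instances of their potentials (weight plus twice the best advantage) starts at most at 1, and a
query multiplies its total over the two branches by at most 1 + 2λ
(`potential_restrictWeight_add_le`). At a leaf, Cauchy–Schwarz and `fiberWeight_sq_le` bound the
weight caught by 2^(n-ℓ) strings by 2^(-ℓ/2) times this product (`listWeight_leaf_le`). Hence q
queries succeed with probability at most 2^(-ℓ/2) (1 + 2λ)^q, which is below (9/10)^ℓ unless ℓ r ≤
1000 q. -/

namespace DecisionTree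

/-! ### Composition and truncation of decision trees -/

/-- Run `t`, then continue with the tree determined by its output. -/
def bind {ι O O' : Type} : DecisionTree ι O → (O → DecisionTree ι O') → DecisionTree ι O'
  | leaf o, k => k o
  | query i t₀ t₁, k => query i (t₀.bind k) (t₁.bind k)

lemma output_bind {ι O O' : Type} (t : DecisionTree ι O) (k : O → DecisionTree ι O')
    (x : ι → Bool) : (t.bind k).output x = (k (t.output x)).output x := by
  induction t with
  | leaf o => rfl
  | query i t₀ t₁ h₀ h₁ => simp only [bind, output, h₀, h₁]; split <;> rfl

lemma cost_bind {ι O O' : Type} (t : DecisionTree ι O) (k : O → DecisionTree ι O')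
    (x : ι → Bool) : (t.bind k).cost x = t.cost x + (k (t.output x)).cost x := by
  induction t with
  | leaf o => simp [bind, output, cost]
  | query i t₀ t₁ h₀ h₁ => simp only [bind, output, cost, h₀, h₁]; split <;> omega

/-- Stop after `q` queries, with output `d` if no leaf has been reached. -/
def truncate {ι O : Type} (d : O) : ℕ → DecisionTree ι O → DecisionTree ι O
  | _, leaf o => leaf o
  | 0, query _ _ _ => leaf d
  | q + 1, query i t₀ t₁ => query i (truncate d q t₀) (truncate d q t₁)

lemma cost_truncate_le {ι O : Type} (d : O) (t : DecisionTree ι O) (q : ℕ) (x : ι → Bool) :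
    (truncate d q t).cost x ≤ q := by
  induction t generalizing q with
  | leaf o => cases q <;> simp [truncate, cost]
  | query i t₀ t₁ h₀ h₁ =>
    cases q with
    | zero => simp [truncate, cost]
    | succ q =>
      simp only [truncate, cost]
      split
      · have := h₁ q; omega
      · have := h₀ q; omega

lemma output_truncate {ι O : Type} (d : O) (t : DecisionTree ι O) (q : ℕ) (x : ι → Bool)
    (h : t.cost x ≤ q) : (truncate d q t).output x = t.output x := by
  induction t generalizing q with
  | leaf o => cases q <;> simp [truncate]
  | query i t₀ t₁ h₀ h₁ =>
    cases q with
    | zero => simp [cost] at h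
    | succ q =>
      simp only [truncate, cost, output] at h ⊢
      split
      · rename_i hx; rw [if_pos hx] at h; exact h₁ q (by omega)
      · rename_i hx; rw [if_neg hx] at h; exact h₀ q (by omega)

end DecisionTree

/-! ### Minimax for finitely many columns -/

/-- Either some distribution makes every row of `A` nonpositive on average, or some mixture of the
rows is positive everywhere. -/
lemma exists_distribution_or_mixture {I J : Type} [Fintype J] [Nonempty I] (A : I → J → ℝ) :
    (∃ μ : J → ℝ, (∀ j, 0 ≤ μ j) ∧ ∑ j, μ j = 1 ∧ ∀ i, ∑ j, μ j * A i j ≤ 0) ∨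
      ∃ v ∈ convexHull ℝ (Set.range A), ∀ j, 0 < v j := by
  classical
  by_contra! hcon
  obtain ⟨h₁, h₂⟩ := hcon
  have hconv : Convex ℝ {v : J → ℝ | ∀ j, 0 < v j} := by
    intro u hu v hv a b ha hb hab j
    have h1 := hu j
    have h2 := hv j
    simp only [Pi.add_apply, Pi.smul_apply, smul_eq_mul]
    rcases ha.eq_or_lt with rfl | ha
    · have : b = 1 := by linarith
      subst this; simpa using h2
    · have := mul_pos ha h1
      have := mul_nonneg hb h2.le
      linarith
  have hopen : IsOpen {v : J → ℝ | ∀ j, 0 < v j} := by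
    simp only [Set.ofPred_forall]
    exact isOpen_iInter_of_finite fun j => isOpen_lt continuous_const (continuous_apply j)
  -- Separate the open positive orthant from the hull of the rows. The functional `g` has
  -- nonpositive coefficients and `u` is nonnegative, so `-g`, normalised, is the distribution.
  obtain ⟨g, u, hg, hu⟩ := geometric_hahn_banach_open hconv hopen
    (convex_convexHull ℝ (Set.range A)) (Set.disjoint_left.2 fun v hv hv' => by
      obtain ⟨j, hj⟩ := h₂ v hv'
      exact absurd (hv j) (not_lt.2 hj))
  have hone : g (fun _ => 1) < u := hg _ fun _ => one_pos
  have hu0 : 0 ≤ u := by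
    by_contra! hneg
    have h1 : g (fun _ => 1) < 0 := hone.trans hneg
    have := hg ((u / g (fun _ => 1)) • fun _ => 1) fun j => by
      simpa using div_pos_of_neg_of_neg hneg h1
    rw [map_smul, smul_eq_mul, div_mul_cancel₀ _ h1.ne] at this
    exact lt_irrefl _ this
  have hc : ∀ j, g (Pi.single j 1) ≤ 0 := by
    intro j
    by_contra! hpos
    have hT : 0 < (u - g (fun _ => 1)) / g (Pi.single j 1) := div_pos (by linarith) hpos
    have := hg ((fun _ => 1) + ((u - g (fun _ => 1)) / g (Pi.single j 1)) • Pi.single j 1)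
      fun k => by
        have : (0 : ℝ) ≤ (Pi.single j 1 : J → ℝ) k := by
          by_cases h : k = j
          · subst h; simp
          · simp [h]
        have := mul_nonneg hT.le this
        simp only [Pi.add_apply, Pi.smul_apply, smul_eq_mul]
        linarith
    rw [map_add, map_smul, smul_eq_mul, div_mul_cancel₀ _ hpos.ne'] at this
    linarith
  have hexp : ∀ v, g v = ∑ j, g (Pi.single j 1) * v j := by
    intro v
    conv_lhs => rw [← Finset.univ_sum_single v]
    rw [map_sum]
    refine Finset.sum_congr rfl fun j _ => ?_
    have : (Pi.single j (v j) : J → ℝ) = v j • Pi.single j 1 := by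
      rw [← Pi.single_smul]; simp
    rw [this, map_smul, smul_eq_mul, mul_comm]
  have hrow : ∀ i, u ≤ g (A i) := fun i => hu _ (subset_convexHull ℝ _ ⟨i, rfl⟩)
  have hs : 0 < ∑ j, -g (Pi.single j 1) := by
    refine (Finset.sum_nonneg fun j _ => neg_nonneg.2 (hc j)).lt_of_ne fun h => ?_
    have h0 := (Finset.sum_eq_zero_iff_of_nonneg fun j _ => neg_nonneg.2 (hc j)).1 h.symm
    have hz : ∀ v, g v = 0 := fun v => by
      rw [hexp]
      refine Finset.sum_eq_zero fun j hj => ?_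
      rw [neg_eq_zero.1 (h0 j hj), zero_mul]
    have := hrow (Classical.arbitrary I)
    rw [hz] at this hone
    linarith
  obtain ⟨i, hi⟩ := h₁ (fun j => (∑ j, -g (Pi.single j 1))⁻¹ * -g (Pi.single j 1))
    (fun j => mul_nonneg (inv_nonneg.2 hs.le) (neg_nonneg.2 (hc j)))
    (by rw [← Finset.mul_sum, inv_mul_cancel₀ hs.ne'])
  simp only [mul_assoc] at hi
  rw [← Finset.mul_sum] at hi
  have h3 := (mul_pos_iff_of_pos_left (inv_pos.2 hs)).1 hi
  have h4 := hrow i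
  rw [hexp] at h4
  simp only [neg_mul, Finset.sum_neg_distrib] at h3
  linarith

/-! ### Scores and the sequential test -/

/-- The score of the prediction `t` for the bit `y`; it has its largest mean at half the bias. -/
noncomputable def score (t : ℝ) (y : Bool) : ℝ := (if y then t else -t) - t ^ 2

lemma score_le (t : ℝ) (y : Bool) : score t y ≤ 1 / 4 := by
  unfold score; split <;> nlinarith [sq_nonneg (t - 1 / 2), sq_nonneg (t + 1 / 2)]

/-- The product equals 1 + t² + t⁴. In the sequential test it means that a small running product for
the wrong value forces a large one for the right value. -/
lemma one_le_one_sub_score_mul (t : ℝ) :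
    1 ≤ (1 - score t false) * (1 - score t true) := by
  simp only [score]; norm_num
  nlinarith [sq_nonneg t, sq_nonneg (t ^ 2)]

/-- The expectation of `F` over `N` independent samples from `p`. -/
def iidExp {K E : Type} [Fintype K] [AddCommMonoid E] [Module ℝ E] (p : K → ℝ) :
    ℕ → (List K → E) → E
  | 0, F => F []
  | N + 1, F => ∑ k, p k • iidExp p N fun l => F (k :: l)

section iidExp

variable {K : Type} [Fintype K] {p : K → ℝ}

lemma iidExp_apply {J : Type} (N : ℕ) (F : List K → J → ℝ) (j : J) :
    iidExp p N F j = iidExp p N fun l => F l j := by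
  induction N generalizing F with
  | zero => rfl
  | succ N ih => simp [iidExp, ih]

lemma iidExp_const_add (hp : ∑ k, p k = 1) (N : ℕ) (c : ℝ) (F : List K → ℝ) :
    iidExp p N (fun l => c + F l) = c + iidExp p N F := by
  induction N generalizing F with
  | zero => rfl
  | succ N ih => simp [iidExp, ih, mul_add, Finset.sum_add_distrib, ← Finset.sum_mul, hp]

lemma iidExp_mono (hp₀ : ∀ k, 0 ≤ p k) (N : ℕ) {F G : List K → ℝ} (h : ∀ l, F l ≤ G l) :
    iidExp p N F ≤ iidExp p N G := by
  induction N generalizing F G with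
  | zero => exact h _
  | succ N ih =>
    exact Finset.sum_le_sum fun k _ => mul_le_mul_of_nonneg_left (ih fun l => h _) (hp₀ k)

lemma iidExp_const (hp : ∑ k, p k = 1) (N : ℕ) (c : ℝ) : iidExp p N (fun _ => c) = c := by
  induction N with
  | zero => rfl
  | succ N ih => simp [iidExp, ih, ← Finset.sum_mul, hp]

/-- With vector values, the errors of a random tree on all inputs at once average to a point of a
convex hull. -/
lemma iidExp_mem_convexHull {E : Type} [AddCommGroup E] [Module ℝ E] (hp₀ : ∀ k, 0 ≤ p k)
    (hp : ∑ k, p k = 1) (N : ℕ) (F : List K → E) {s : Set E} (hF : ∀ l, F l ∈ s) :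
    iidExp p N F ∈ convexHull ℝ s := by
  induction N generalizing F with
  | zero => exact subset_convexHull ℝ s (hF _)
  | succ N ih =>
    exact (convex_convexHull ℝ s).sum_mem (fun k _ => hp₀ k) hp fun k _ => ih _ fun l => hF _

end iidExp

open Classical in
/-- Run the given prediction trees in order and multiply `M y` by one minus the score for `y`;
accept the first `y` for which the product drops to `ε`. -/
noncomputable def sequentialTest {ι : Type} (ε : ℝ) :
    List (DecisionTree ι ℝ) → (Bool → ℝ) → DecisionTree ι Bool
  | [], M => .leaf (decide (M true ≤ ε))
  | D :: l, M =>
    if M false ≤ ε then .leaf false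
    else if M true ≤ ε then .leaf true
    else D.bind fun t => sequentialTest ε l fun y => M y * (1 - score t y)

-- In each round played, `M y` shrinks in mean by the factor 1 - σ, with σ the mean score for `y`.
-- Accepting the wrong value forces `M y` ≥ 1/ε, which gives the term ε. While the test runs, `M y`
-- > ε, so the mean decrease σ `M y` pays for the expected queries, at most σ/λ. The last term
-- covers running out of samples.
open Classical in
lemma iidExp_sequentialTest_le {ι K : Type} [Fintype K] {p : K → ℝ} (hp₀ : ∀ k, 0 ≤ p k)
    (hp : ∑ k, p k = 1) (D : K → DecisionTree ι ℝ) (x : ι → Bool) (y : Bool)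
    {ε lam s α : ℝ} (hε : 0 < ε) (hlam : 0 < lam) (hs : 0 ≤ s) (hs₁ : s ≤ 1) (hα : 0 ≤ α)
    (hsσ : s ≤ ∑ k, p k * score ((D k).output x) y)
    (hσ : lam * ∑ k, p k * ((D k).cost x : ℝ) ≤ ∑ k, p k * score ((D k).output x) y)
    (N : ℕ) (M : Bool → ℝ) (hM : ∀ b, 0 < M b) (hM₁ : 1 ≤ M false * M true) :
    iidExp p N (fun l =>
        (if (sequentialTest ε (l.map D) M).output x = y then (0 : ℝ) else 1) +
          α * (sequentialTest ε (l.map D) M).cost x) ≤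
      (ε + α / (ε * lam) + (1 - s) ^ N / ε) * M y := by
  have hA : 0 ≤ α / (ε * lam) := by positivity
  have hN : ∀ N, 0 ≤ (1 - s) ^ N / ε := fun N => div_nonneg (pow_nonneg (by linarith) N) hε.le
  have hnn : ∀ N, 0 ≤ (ε + α / (ε * lam) + (1 - s) ^ N / ε) * M y := fun N =>
    mul_nonneg (by linarith [hN N]) (hM y).le
  have hreject : ∀ N b, b ≠ y → M b ≤ ε → 1 ≤ (ε + α / (ε * lam) + (1 - s) ^ N / ε) * M y := by
    intro N b hb hMb
    have h1 : 1 ≤ M b * M y := by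
      cases b <;> cases y <;> simp_all [mul_comm]
    have h2 : M b * M y ≤ ε * M y := mul_le_mul_of_nonneg_right hMb (hM y).le
    nlinarith [hN N, hM y, mul_nonneg hA (hM y).le, mul_nonneg (hN N) (hM y).le]
  induction N generalizing M with
  | zero =>
    simp only [iidExp, List.map_nil, sequentialTest, DecisionTree.output, DecisionTree.cost,
      Nat.cast_zero, mul_zero, add_zero]
    split
    · exact hnn 0
    · rename_i h
      cases y with
      | false =>
        refine hreject 0 true (by simp) ?_
        simpa using h
      | true =>
        have h1 : ε < M true := by simpa using h
        have h2 : 1 ≤ 1 / ε * M true := by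
          rw [one_div, inv_mul_eq_div, one_le_div hε]; exact h1.le
        rw [pow_zero]
        nlinarith [hM true, mul_nonneg hA (hM true).le, mul_pos hε (hM true)]
  | succ N ih =>
    by_cases h0 : M false ≤ ε
    · have : ∀ k (l : List K), sequentialTest ε ((k :: l).map D) M = .leaf false := fun k l => by
        simp [sequentialTest, h0]
      simp only [iidExp, this, DecisionTree.output, DecisionTree.cost, Nat.cast_zero, mul_zero,
        add_zero, iidExp_const hp, ← Finset.sum_smul, hp, one_smul]
      split
      · exact hnn _
      · exact hreject _ false (by assumption) h0
    by_cases h1 : M true ≤ ε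
    · have : ∀ k (l : List K), sequentialTest ε ((k :: l).map D) M = .leaf true := fun k l => by
        simp [sequentialTest, h0, h1]
      simp only [iidExp, this, DecisionTree.output, DecisionTree.cost, Nat.cast_zero, mul_zero,
        add_zero, iidExp_const hp, ← Finset.sum_smul, hp, one_smul]
      split
      · exact hnn _
      · exact hreject _ true (by assumption) h1
    have hMy : ε < M y := by cases y <;> simp_all
    set C := ε + α / (ε * lam) + (1 - s) ^ N / ε with hC
    have hstep : ∀ k, iidExp p N (fun l =>
        (if (sequentialTest ε ((k :: l).map D) M).output x = y then (0 : ℝ) else 1) +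
          α * (sequentialTest ε ((k :: l).map D) M).cost x) ≤
        α * (D k).cost x + C * (M y * (1 - score ((D k).output x) y)) := by
      intro k
      set M' : Bool → ℝ := fun b => M b * (1 - score ((D k).output x) b) with hM'
      have hpos : ∀ b, 0 < 1 - score ((D k).output x) b := fun b => by
        linarith [score_le ((D k).output x) b]
      have hM'pos : ∀ b, 0 < M' b := fun b => mul_pos (hM b) (hpos b)
      have hM'₁ : 1 ≤ M' false * M' true := by
        have := one_le_mul_of_one_le_of_one_le hM₁ (one_le_one_sub_score_mul ((D k).output x))
        simp only [hM']; linarith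
      have hC0 : 0 ≤ C := by have := hN N; positivity
      -- `hnn` and `hreject` mention `M`, so the induction hypothesis asks for them again at `M'`.
      have := ih M' hM'pos hM'₁ (fun N => mul_nonneg (by linarith [hN N]) (hM'pos y).le) (by
        intro N b hb hMb
        have h1 : 1 ≤ M' b * M' y := by
          cases b <;> cases y <;> first | exact absurd rfl hb | linarith
        have h2 : M' b * M' y ≤ ε * M' y := mul_le_mul_of_nonneg_right hMb (hM'pos y).le
        nlinarith [mul_nonneg hA (hM'pos y).le, mul_nonneg (hN N) (hM'pos y).le])
      have heq : (fun l : List K =>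
          (if (sequentialTest ε ((k :: l).map D) M).output x = y then (0 : ℝ) else 1) +
          α * (sequentialTest ε ((k :: l).map D) M).cost x) = fun l =>
          α * (D k).cost x +
          ((if (sequentialTest ε (l.map D) M').output x = y then (0 : ℝ) else 1) +
          α * (sequentialTest ε (l.map D) M').cost x) := by
        funext l
        simp only [List.map_cons, sequentialTest, if_neg h0, if_neg h1, DecisionTree.output_bind,
          DecisionTree.cost_bind, Nat.cast_add]
        ring
      rw [heq, iidExp_const_add hp]
      linarith
    set σ := ∑ k, p k * score ((D k).output x) y with hσdef
    calc _ ≤ ∑ k, p k * (α * (D k).cost x + C * (M y * (1 - score ((D k).output x) y))) :=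
          Finset.sum_le_sum fun k _ => mul_le_mul_of_nonneg_left (hstep k) (hp₀ k)
      _ = α * ∑ k, p k * ((D k).cost x : ℝ) + C * M y * (1 - σ) := by
          have : 1 - σ = ∑ k, p k * (1 - score ((D k).output x) y) := by
            simp only [mul_sub, mul_one, Finset.sum_sub_distrib, hp, hσdef]
          rw [this, Finset.mul_sum, Finset.mul_sum, ← Finset.sum_add_distrib]
          exact Finset.sum_congr rfl fun k _ => by ring
      _ ≤ _ := by
          have hσ0 : 0 ≤ σ := hs.trans hsσ
          have e1 : α * ∑ k, p k * ((D k).cost x : ℝ) ≤ α / (ε * lam) * σ * M y := by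
            have : ∑ k, p k * ((D k).cost x : ℝ) ≤ σ / lam := by
              rw [le_div_iff₀ hlam]; linarith
            calc _ ≤ α * (σ / lam) := mul_le_mul_of_nonneg_left this hα
              _ = α / (ε * lam) * σ * ε := by field_simp
              _ ≤ _ := mul_le_mul_of_nonneg_left hMy.le (mul_nonneg hA hσ0)
          have e2 : (1 - s) ^ N / ε * (1 - σ) ≤ (1 - s) ^ (N + 1) / ε := by
            rw [pow_succ, mul_div_right_comm]
            exact mul_le_mul_of_nonneg_left (by linarith) (hN N)
          have e3 := mul_le_mul_of_nonneg_right e2 (hM y).le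
          have e4 : 0 ≤ ε * σ * M y := mul_nonneg (mul_nonneg hε.le hσ0) (hM y).le
          rw [hC]
          nlinarith

open Classical in
/-- The indicator of the inputs on which `T` does not compute `f`. -/
noncomputable def DecisionTree.error {ι O : Type} {X : Set (ι → Bool)} (f : X → O)
    (T : DecisionTree ι O) (x : X) : ℝ := if T.output x.1 = f x then 0 else 1

/-- A point of the hull is a finite mixture of trees, and its coordinates are the error
probabilities. -/
lemma randQueryComplexity_functionRel_le {ι O : Type} {X : Set (ι → Bool)} (f : X → O) (B : ℕ)
    {γ : ℝ} {v : X → ℝ}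
    (hv : v ∈ convexHull ℝ (DecisionTree.error f '' {T | ∀ x, T.cost x ≤ B}))
    (hγ : ∀ x, v x ≤ 1 - γ) : randQueryComplexity γ (functionRel f) ≤ B := by
  classical
  obtain ⟨K, _, p, z, hp₀, hp, hz, rfl⟩ := mem_convexHull_iff_exists_fintype.1 hv
  choose T hT hTz using hz
  have hsum : ∑ k, ENNReal.ofReal (p k) = 1 := by
    rw [← ENNReal.ofReal_sum_of_nonneg fun k _ => hp₀ k, hp, ENNReal.ofReal_one]
  refine iInf₂_le_of_le ((PMF.ofFintype (fun k => ENNReal.ofReal (p k)) hsum).map T) ?_ ?_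
  · intro x
    rw [RandAlg.prob, PMF.toOuterMeasure_map_apply, PMF.toOuterMeasure_apply_fintype]
    have : ∀ k, (T ⁻¹' {D | D.output x.1 ∈ functionRel f x}).indicator
        (PMF.ofFintype (fun k => ENNReal.ofReal (p k)) hsum) k =
        ENNReal.ofReal (p k * (1 - z k x)) := by
      intro k
      rw [← hTz k]
      by_cases h : (T k).output x.1 = f x <;>
        simp [Set.indicator, functionRel, DecisionTree.error, h]
    rw [Finset.sum_congr rfl fun k _ => this k, ← ENNReal.ofReal_sum_of_nonneg]
    · refine ENNReal.ofReal_le_ofReal ?_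
      have := hγ x
      simp only [Finset.sum_apply, Pi.smul_apply, smul_eq_mul] at this
      simp only [mul_sub, mul_one, Finset.sum_sub_distrib, hp]
      linarith
    · intro k _
      refine mul_nonneg (hp₀ k) ?_
      rw [← hTz k, DecisionTree.error]
      split <;> norm_num
  · refine iSup₂_le fun D hD => iSup₂_le fun x _ => ?_
    obtain ⟨k, -, rfl⟩ := (PMF.mem_support_map_iff _ _ _).1 hD
    exact_mod_cast hT k x

/-- A mixture of prediction trees whose mean score exceeds `lam` times its mean cost on every
input can be turned into a bounded-error algorithm of cost about `81 / lam`. -/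
lemma randQueryComplexity_le_of_score {ι : Type} [Finite ι] {X : Set (ι → Bool)} (f : X → Bool)
    {lam : ℝ} (hlam : 0 < lam) (B : ℕ) (hB : 81 ≤ lam * (B + 1)) {v : X → ℝ}
    (hv : v ∈ convexHull ℝ (Set.range fun (D : DecisionTree ι ℝ) (x : X) =>
      score (D.output x) (f x) - lam * D.cost x)) (hpos : ∀ x, 0 < v x) :
    randQueryComplexity (2 / 3) (functionRel f) ≤ B := by
  classical
  obtain ⟨K, _, p, z, hp₀, hp, hz, rfl⟩ := mem_convexHull_iff_exists_fintype.1 hv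
  choose D hD using hz
  have hσ : ∀ x : X, lam * ∑ k, p k * ((D k).cost x : ℝ) <
      ∑ k, p k * score ((D k).output x) (f x) := fun x => by
    have := hpos x
    simp only [Finset.sum_apply, Pi.smul_apply, smul_eq_mul, ← hD, mul_sub,
      Finset.sum_sub_distrib] at this
    rw [Finset.mul_sum]
    have h2 : ∑ k, p k * (lam * ((D k).cost x : ℝ)) = ∑ k, lam * (p k * ((D k).cost x : ℝ)) :=
      Finset.sum_congr rfl fun k _ => by ring
    linarith
  have hσ₀ : ∀ x : X, 0 < ∑ k, p k * score ((D k).output x) (f x) := fun x =>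
    (mul_nonneg hlam.le (Finset.sum_nonneg fun k _ =>
      mul_nonneg (hp₀ k) (Nat.cast_nonneg _))).trans_lt (hσ x)
  obtain ⟨s, hs₀, hs₁, hs⟩ : ∃ s : ℝ, 0 < s ∧ s ≤ 1 ∧
      ∀ x : X, s ≤ ∑ k, p k * score ((D k).output x) (f x) := by
    rcases isEmpty_or_nonempty X with h | h
    · exact ⟨1, one_pos, le_rfl, fun x => h.elim x⟩
    · obtain ⟨x₀, hx₀⟩ := Finite.exists_min fun x : X => ∑ k, p k * score ((D k).output x) (f x)
      exact ⟨min 1 _, lt_min one_pos (hσ₀ x₀), min_le_left _ _,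
        fun x => (min_le_right _ _).trans (hx₀ x)⟩
  -- The gap `s` may be tiny, but it affects only the number of rounds, not the cost bound.
  obtain ⟨N, hN⟩ := exists_pow_lt_of_lt_one (show (0 : ℝ) < 1 / 81 by norm_num)
    (show 1 - s < 1 by linarith)
  set T : List K → DecisionTree ι Bool := fun l =>
    sequentialTest (1 / 9) (l.map D) fun _ => 1 with hT
  refine randQueryComplexity_functionRel_le f B
    (iidExp_mem_convexHull (E := X → ℝ) hp₀ hp N
      (fun l => DecisionTree.error f ((T l).truncate false B))
      fun l => ⟨_, fun x => DecisionTree.cost_truncate_le _ _ _ _, rfl⟩) fun x => ?_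
  rw [iidExp_apply]
  have hB0 : (0 : ℝ) < B + 1 := by positivity
  -- With α = 1/(B+1), a run exceeding `B` queries is charged at least one error, which covers
  -- truncation. With ε = 1/9 each of the three terms is at most 1/9.
  have key := iidExp_sequentialTest_le hp₀ hp D x.1 (f x) (ε := 1 / 9) (lam := lam) (s := s)
    (α := 1 / (B + 1)) (by norm_num) hlam hs₀.le hs₁ (by positivity) (hs x) (hσ x).le N
    (fun _ => 1) (fun _ => one_pos) (by norm_num)
  refine (iidExp_mono hp₀ N fun l => ?_).trans (key.trans ?_)
  · by_cases hc : (T l).cost x.1 ≤ B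
    · simp only [DecisionTree.error, DecisionTree.output_truncate _ _ _ _ hc]
      exact le_add_of_nonneg_right (by positivity)
    · have h1 : DecisionTree.error f ((T l).truncate false B) x ≤ 1 := by
        rw [DecisionTree.error]; split <;> norm_num
      have h2 : 1 ≤ 1 / ((B : ℝ) + 1) * (T l).cost x.1 := by
        rw [one_div, inv_mul_eq_div, one_le_div hB0]
        exact_mod_cast Nat.lt_of_not_le hc
      refine h1.trans (h2.trans (le_add_of_nonneg_left ?_))
      split <;> norm_num
  · have : 1 / ((B : ℝ) + 1) / (1 / 9 * lam) ≤ 1 / 9 := by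
      rw [div_div, div_le_div_iff₀ (by positivity) (by norm_num)]
      linarith
    have h3 : (1 - s) ^ N / (1 / 9) ≤ 1 / 9 := by
      rw [div_le_iff₀ (by norm_num)]; linarith
    linarith

/-! ### Advantage and potential of a weighted instance -/

section Potential

variable {m : ℕ} {X : Set (Fin m → Bool)}

/-- The restriction of the weights `w` to the inputs whose bit `j` is `b`. -/
noncomputable def restrictWeight (w : X → ℝ) (j : Fin m) (b : Bool) (x : X) : ℝ :=
  if x.1 j = b then w x else 0

variable {w : X → ℝ}

lemma restrictWeight_nonneg (hw : ∀ x, 0 ≤ w x) (j : Fin m) (b : Bool) (x : X) :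
    0 ≤ restrictWeight w j b x := by
  unfold restrictWeight; split
  · exact hw x
  · exact le_rfl

variable [Fintype X]

/-- The advantage of the prediction tree `D` for `f`: its total score minus `lam` times its total
cost, under the weights `w`. -/
noncomputable def advantage (f : X → Bool) (lam : ℝ) (w : X → ℝ)
    (D : DecisionTree (Fin m) ℝ) : ℝ :=
  ∑ x : X, w x * (score (D.output x.1) (f x) - lam * D.cost x.1)

/-- The largest advantage under the weights `w`. -/
noncomputable def maxAdvantage (f : X → Bool) (lam : ℝ) (w : X → ℝ) : ℝ :=
  ⨆ D, advantage f lam w D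

/-- The total weight of the inputs with value `b`. -/
noncomputable def fiberWeight (f : X → Bool) (w : X → ℝ) (b : Bool) : ℝ :=
  ∑ x : X, if f x = b then w x else 0

/-- The total weight plus twice the largest advantage. -/
noncomputable def potential (f : X → Bool) (lam : ℝ) (w : X → ℝ) : ℝ :=
  fiberWeight f w false + fiberWeight f w true + 2 * maxAdvantage f lam w

variable {f : X → Bool} {lam : ℝ}

lemma fiberWeight_nonneg (hw : ∀ x, 0 ≤ w x) (b : Bool) : 0 ≤ fiberWeight f w b :=
  Finset.sum_nonneg fun x _ => by split <;> simp [hw]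

lemma fiberWeight_add : fiberWeight f w false + fiberWeight f w true = ∑ x : X, w x := by
  rw [fiberWeight, fiberWeight, ← Finset.sum_add_distrib]
  exact Finset.sum_congr rfl fun x _ => by cases f x <;> simp

lemma bddAbove_advantage (hw : ∀ x, 0 ≤ w x) (hlam : 0 ≤ lam) :
    BddAbove (Set.range (advantage f lam w)) := by
  refine ⟨∑ x : X, w x * (1 / 4), ?_⟩
  rintro _ ⟨D, rfl⟩
  refine Finset.sum_le_sum fun x _ => mul_le_mul_of_nonneg_left ?_ (hw x)
  have := score_le (D.output x.1) (f x)
  have : 0 ≤ lam * (D.cost x.1 : ℝ) := by positivity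
  linarith

lemma advantage_leaf (t : ℝ) : advantage f lam w (.leaf t) =
    fiberWeight f w true * (t - t ^ 2) + fiberWeight f w false * (-t - t ^ 2) := by
  simp only [advantage, fiberWeight, DecisionTree.output, DecisionTree.cost, Nat.cast_zero,
    mul_zero, sub_zero, Finset.sum_mul, ← Finset.sum_add_distrib]
  exact Finset.sum_congr rfl fun x _ => by cases f x <;> simp [score]

lemma maxAdvantage_nonneg (hw : ∀ x, 0 ≤ w x) (hlam : 0 ≤ lam) : 0 ≤ maxAdvantage f lam w := by
  refine le_trans ?_ (le_ciSup (bddAbove_advantage (f := f) hw hlam) (.leaf 0))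
  simp [advantage_leaf]

lemma advantage_query (j : Fin m) (D₀ D₁ : DecisionTree (Fin m) ℝ) :
    advantage f lam w (.query j D₀ D₁) =
      advantage f lam (restrictWeight w j false) D₀ +
        advantage f lam (restrictWeight w j true) D₁ -
          lam * (fiberWeight f w false + fiberWeight f w true) := by
  rw [fiberWeight_add]
  simp only [advantage, Finset.mul_sum, ← Finset.sum_add_distrib, ← Finset.sum_sub_distrib]
  refine Finset.sum_congr rfl fun x _ => ?_
  cases h : x.1 j <;> simp [restrictWeight, DecisionTree.output, DecisionTree.cost, h] <;> ring

/-- Querying `j` first and then following a separate tree on each branch is one competitor in the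
supremum. -/
lemma maxAdvantage_restrictWeight_add_le (hw : ∀ x, 0 ≤ w x) (hlam : 0 ≤ lam) (j : Fin m) :
    maxAdvantage f lam (restrictWeight w j false) +
      maxAdvantage f lam (restrictWeight w j true) ≤
        maxAdvantage f lam w + lam * (fiberWeight f w false + fiberWeight f w true) := by
  have : Nonempty (DecisionTree (Fin m) ℝ) := ⟨.leaf 0⟩
  rw [← le_sub_iff_add_le]
  refine ciSup_le fun D₀ => ?_
  rw [le_sub_comm]
  refine ciSup_le fun D₁ => ?_
  have := le_ciSup (bddAbove_advantage (f := f) hw hlam) (.query j D₀ D₁)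
  rw [advantage_query] at this
  rw [maxAdvantage]
  linarith

lemma potential_nonneg (hw : ∀ x, 0 ≤ w x) (hlam : 0 ≤ lam) : 0 ≤ potential f lam w := by
  have h1 := maxAdvantage_nonneg (f := f) hw hlam
  have h2 := fiberWeight_nonneg (f := f) hw false
  have h3 := fiberWeight_nonneg (f := f) hw true
  unfold potential; linarith

lemma potential_restrictWeight_add_le (hw : ∀ x, 0 ≤ w x) (hlam : 0 ≤ lam) (j : Fin m) :
    potential f lam (restrictWeight w j false) + potential f lam (restrictWeight w j true) ≤
      (1 + 2 * lam) * potential f lam w := by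
  have h := maxAdvantage_restrictWeight_add_le (f := f) hw hlam j
  have h1 := maxAdvantage_nonneg (f := f) hw hlam
  have hsum : ∑ x : X, restrictWeight w j false x + ∑ x : X, restrictWeight w j true x =
      ∑ x : X, w x := by
    rw [← Finset.sum_add_distrib]
    exact Finset.sum_congr rfl fun x _ => by cases h : x.1 j <;> simp [restrictWeight, h]
  simp only [potential, fiberWeight_add] at h ⊢
  nlinarith [mul_nonneg hlam h1]

/-- For fiber weights a, b one has a² + b² = ((a+b)² + (a-b)²)/2. A leaf already gains
(a-b)²/(4(a+b)), so the advantage in the potential pays for the imbalance. -/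
lemma fiberWeight_sq_le (hw : ∀ x, 0 ≤ w x) (hlam : 0 ≤ lam) :
    ∑ b, fiberWeight f w b ^ 2 ≤ potential f lam w ^ 2 / 2 := by
  have hV := fun t => le_ciSup (bddAbove_advantage (f := f) hw hlam) (.leaf t)
  simp only [advantage_leaf] at hV
  have ha := fiberWeight_nonneg (f := f) hw false
  have hb := fiberWeight_nonneg (f := f) hw true
  rw [Fintype.sum_bool, potential, maxAdvantage]
  set a := fiberWeight f w false
  set b := fiberWeight f w true
  set V := ⨆ D, advantage f lam w D
  rcases (add_nonneg ha hb).eq_or_lt with h | h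
  · have h1 : a = 0 := by linarith
    have h2 : b = 0 := by linarith
    rw [h1, h2]; linarith [sq_nonneg (0 + 0 + 2 * V)]
  -- Half the bias is the label that maximises the advantage of a leaf.
  · have h1 := hV ((b - a) / (2 * (a + b)))
    have h2 : b * ((b - a) / (2 * (a + b)) - ((b - a) / (2 * (a + b))) ^ 2) +
        a * (-((b - a) / (2 * (a + b))) - ((b - a) / (2 * (a + b))) ^ 2) =
        (b - a) ^ 2 / (4 * (a + b)) := by
      field_simp; ring
    rw [h2, div_le_iff₀ (by linarith)] at h1
    nlinarith [sq_nonneg V]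

end Potential

/-! ### List decoding under product weights -/

section DirectProduct

variable {m n : ℕ} {X : Set (Fin m → Bool)} [Fintype X]

/-- The concatenation of `n` inputs. -/
def flatten (x : Fin n → X) (i : Fin n × Fin m) : Bool := (x i.1).1 i.2

open Classical in
/-- The weight of the inputs for which `T` outputs a correct list, when the instances have the
weights `w`. -/
noncomputable def listWeight (f : X → Bool) (ℓ : ℕ) (w : Fin n → X → ℝ)
    (T : DecisionTree (Fin n × Fin m) (Finset (Fin n → Bool))) : ℝ :=
  ∑ x : Fin n → X, (∏ i, w i (x i)) *
    if T.output (flatten x) ∈ listDecoding n ℓ (fun i => f (x i)) then 1 else 0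

variable {f : X → Bool} {ℓ : ℕ} {w : Fin n → X → ℝ} {lam : ℝ}

lemma listWeight_query (i : Fin n) (j : Fin m)
    (T₀ T₁ : DecisionTree (Fin n × Fin m) (Finset (Fin n → Bool))) :
    listWeight f ℓ w (.query (i, j) T₀ T₁) =
      listWeight f ℓ (Function.update w i (restrictWeight (w i) j false)) T₀ +
        listWeight f ℓ (Function.update w i (restrictWeight (w i) j true)) T₁ := by
  classical
  have hprod : ∀ b (x : Fin n → X),
      ∏ k, Function.update w i (restrictWeight (w i) j b) k (x k) =
        if (x i).1 j = b then ∏ k, w k (x k) else 0 := by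
    intro b x
    split
    · rename_i h
      refine Finset.prod_congr rfl fun k _ => ?_
      by_cases hk : k = i
      · subst hk; simp [restrictWeight, h]
      · simp [hk]
    · rename_i h
      exact Finset.prod_eq_zero (Finset.mem_univ i) (by simp [restrictWeight, h])
  simp only [listWeight, ← Finset.sum_add_distrib, hprod]
  refine Finset.sum_congr rfl fun x _ => ?_
  have : flatten x (i, j) = (x i).1 j := rfl
  cases h : (x i).1 j <;> simp [DecisionTree.output, this, h]

lemma prod_fiberWeight (y : Fin n → Bool) : ∏ i, fiberWeight f (w i) (y i) =
    ∑ x : Fin n → X, if (fun i => f (x i)) = y then ∏ i, w i (x i) else 0 := by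
  simp only [fiberWeight]
  rw [Finset.prod_univ_sum, Fintype.piFinset_univ]
  refine Finset.sum_congr rfl fun x _ => ?_
  split
  · rename_i h
    subst h
    simp
  · rename_i h
    obtain ⟨i, hi⟩ := Function.ne_iff.1 h
    exact Finset.prod_eq_zero (Finset.mem_univ i) (if_neg hi)

lemma listWeight_leaf {S : Finset (Fin n → Bool)} (hS : S.card = 2 ^ (n - ℓ)) :
    listWeight f ℓ w (.leaf S) = ∑ y ∈ S, ∏ i, fiberWeight f (w i) (y i) := by
  simp only [prod_fiberWeight]
  rw [Finset.sum_comm]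
  refine Finset.sum_congr rfl fun x _ => ?_
  rw [Finset.sum_ite_eq]
  by_cases h : (fun i => f (x i)) ∈ S <;>
    simp [listDecoding, DecisionTree.output, hS, h]

/-- After Cauchy–Schwarz over `S`, extending the sum of squares to all strings makes it factor over
the instances. -/
lemma listWeight_leaf_le (hℓ : ℓ ≤ n) (hw : ∀ i x, 0 ≤ w i x) (hlam : 0 ≤ lam)
    (S : Finset (Fin n → Bool)) :
    listWeight f ℓ w (.leaf S) ≤ √((1 / 2) ^ ℓ) * ∏ i, potential f lam (w i) := by
  have hΦ : 0 ≤ ∏ i, potential f lam (w i) :=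
    Finset.prod_nonneg fun i _ => potential_nonneg (hw i) hlam
  by_cases hS : S.card = 2 ^ (n - ℓ)
  swap
  · have : listWeight f ℓ w (.leaf S) = 0 :=
      Finset.sum_eq_zero fun x _ => by simp [listDecoding, DecisionTree.output, hS]
    rw [this]; positivity
  have hsq : listWeight f ℓ w (.leaf S) ^ 2 ≤ (1 / 2) ^ ℓ * (∏ i, potential f lam (w i)) ^ 2 :=
    calc _ ≤ (S.card : ℝ) * ∑ y ∈ S, (∏ i, fiberWeight f (w i) (y i)) ^ 2 := by
          rw [listWeight_leaf hS]; exact sq_sum_le_card_mul_sum_sq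
      _ ≤ (S.card : ℝ) * ∑ y : Fin n → Bool, (∏ i, fiberWeight f (w i) (y i)) ^ 2 :=
          mul_le_mul_of_nonneg_left (Finset.sum_le_sum_of_subset_of_nonneg (Finset.subset_univ S)
            fun y _ _ => sq_nonneg _) (Nat.cast_nonneg _)
      _ = (S.card : ℝ) * ∏ i, ∑ b, fiberWeight f (w i) b ^ 2 := by
          rw [Finset.prod_univ_sum, Fintype.piFinset_univ]
          simp only [Finset.prod_pow]
      _ ≤ (S.card : ℝ) * ∏ i, potential f lam (w i) ^ 2 / 2 :=
          mul_le_mul_of_nonneg_left (Finset.prod_le_prod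
            (fun i _ => Finset.sum_nonneg fun b _ => sq_nonneg _)
            fun i _ => fiberWeight_sq_le (hw i) hlam) (Nat.cast_nonneg _)
      _ = _ := by
          have : (2 : ℝ) ^ n = 2 ^ (n - ℓ) * 2 ^ ℓ := by rw [← pow_add, Nat.sub_add_cancel hℓ]
          rw [Finset.prod_div_distrib, Finset.prod_pow, Finset.prod_const, Finset.card_univ,
            Fintype.card_fin, hS, this]
          push_cast
          rw [one_div, inv_pow]
          field_simp
  rw [← Real.sqrt_sq hΦ, ← Real.sqrt_mul (by positivity)]
  exact Real.le_sqrt_of_sq_le hsq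

/-- The induction needs depth at most `q` on every path, including paths no input of the domain
follows; truncation provides this. The label `∅` at a cut is harmless, since the leaf bound holds
for every label. -/
lemma listWeight_truncate_le (hℓ : ℓ ≤ n) (hlam : 0 ≤ lam) (hw : ∀ i x, 0 ≤ w i x)
    (T : DecisionTree (Fin n × Fin m) (Finset (Fin n → Bool))) (q : ℕ) :
    listWeight f ℓ w (T.truncate ∅ q) ≤
      √((1 / 2) ^ ℓ) * (1 + 2 * lam) ^ q * ∏ i, potential f lam (w i) := by
  have hΦ : ∀ (w : Fin n → X → ℝ), (∀ i x, 0 ≤ w i x) → 0 ≤ ∏ i, potential f lam (w i) :=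
    fun w hw => Finset.prod_nonneg fun i _ => potential_nonneg (hw i) hlam
  have hleaf : ∀ (w : Fin n → X → ℝ), (∀ i x, 0 ≤ w i x) → ∀ S q,
      listWeight f ℓ w (.leaf S) ≤
        √((1 / 2) ^ ℓ) * (1 + 2 * lam) ^ q * ∏ i, potential f lam (w i) := by
    intro w hw S q
    refine (listWeight_leaf_le hℓ hw hlam S).trans (mul_le_mul_of_nonneg_right ?_ (hΦ w hw))
    exact le_mul_of_one_le_right (Real.sqrt_nonneg _) (one_le_pow₀ (by linarith))
  induction T generalizing q w with
  | leaf S => cases q <;> exact hleaf w hw S _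
  | query ij T₀ T₁ h₀ h₁ =>
    cases q with
    | zero => exact hleaf w hw ∅ 0
    | succ q =>
      obtain ⟨i, j⟩ := ij
      have hup : ∀ b k x, 0 ≤ Function.update w i (restrictWeight (w i) j b) k x := by
        intro b k x
        by_cases hk : k = i
        · subst hk; simpa using restrictWeight_nonneg (hw k) j b x
        · simpa [hk] using hw k x
      have hprod : ∀ b, ∏ k, potential f lam (Function.update w i (restrictWeight (w i) j b) k) =
          potential f lam (restrictWeight (w i) j b) *
            ∏ k ∈ Finset.univ \ {i}, potential f lam (w k) := by
        intro b
        have : ∀ k, potential f lam (Function.update w i (restrictWeight (w i) j b) k) =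
            Function.update (fun k => potential f lam (w k)) i
              (potential f lam (restrictWeight (w i) j b)) k := by
          intro k
          by_cases hk : k = i
          · subst hk; simp
          · simp [hk]
        simp only [this]
        exact Finset.prod_update_of_mem (Finset.mem_univ i) _ _
      have hrest : 0 ≤ ∏ k ∈ Finset.univ \ {i}, potential f lam (w k) :=
        Finset.prod_nonneg fun k _ => potential_nonneg (hw k) hlam
      have hall : ∏ k, potential f lam (w k) = potential f lam (w i) *
          ∏ k ∈ Finset.univ \ {i}, potential f lam (w k) :=
        Finset.prod_eq_mul_prod_sdiff_singleton_of_mem (Finset.mem_univ i) _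
      have e₀ := h₀ (hup false) q
      have e₁ := h₁ (hup true) q
      rw [hprod] at e₀ e₁
      rw [DecisionTree.truncate, listWeight_query, hall, pow_succ]
      have hstep := mul_le_mul_of_nonneg_right
        (potential_restrictWeight_add_le (f := f) (hw i) hlam j) hrest
      have hc : 0 ≤ √((1 / 2 : ℝ) ^ ℓ) * (1 + 2 * lam) ^ q := by positivity
      have := mul_le_mul_of_nonneg_left hstep hc
      linarith

end DirectProduct

/-! ### From worst-case success to the query bound -/

lemma flatten_mem_powDomain {m n : ℕ} {X : Set (Fin m → Bool)} (x : Fin n → X) :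
    flatten x ∈ powDomain X n := fun i => (x i).2

/-- Under any product distribution, an algorithm for list decoding with worst-case success
probability `δ` has average success probability at least `δ`. -/
lemma le_of_listWeight_le {m n ℓ : ℕ} {X : Set (Fin m → Bool)} [Fintype X] {f : X → Bool}
    {R : RandAlg (Fin n × Fin m) (Finset (Fin n → Bool))} {δ β : ℝ} {μ : X → ℝ}
    (hβ : 0 ≤ β) (hμ₀ : ∀ x, 0 ≤ μ x) (hμ : ∑ x, μ x = 1)
    (hR : ∀ x : powDomain X n,
      ENNReal.ofReal δ ≤ R.prob x (listDecoding n ℓ (directProduct f n x)))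
    (h : ∀ T ∈ R.support, listWeight f ℓ (fun _ => μ) T ≤ β) : δ ≤ β := by
  classical
  set W : (Fin n → X) → ℝ := fun x => ∏ i, μ (x i) with hW
  have hW₀ : ∀ x, 0 ≤ W x := fun x => Finset.prod_nonneg fun i _ => hμ₀ _
  have hW₁ : ∑ x, ENNReal.ofReal (W x) = 1 := by
    rw [← ENNReal.ofReal_sum_of_nonneg fun x _ => hW₀ x]
    have : ∑ x, W x = ∏ _i : Fin n, ∑ x, μ x := by
      rw [Finset.prod_univ_sum, Fintype.piFinset_univ]
    rw [this, hμ]; simp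
  refine (ENNReal.ofReal_le_ofReal_iff hβ).1 ?_
  calc ENNReal.ofReal δ = ∑ x, ENNReal.ofReal (W x) * ENNReal.ofReal δ := by
        rw [← Finset.sum_mul, hW₁, one_mul]
    _ ≤ ∑ x, ENNReal.ofReal (W x) *
          R.prob (flatten x) (listDecoding n ℓ fun i => f (x i)) :=
        Finset.sum_le_sum fun x _ =>
          mul_le_mul_right (hR ⟨flatten x, flatten_mem_powDomain x⟩) _
    _ = ∑' T, ∑ x, ENNReal.ofReal (W x) *
          {D : DecisionTree _ _ | D.output (flatten x) ∈
            listDecoding n ℓ fun i => f (x i)}.indicator R T := by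
        simp only [RandAlg.prob, PMF.toOuterMeasure_apply, ← ENNReal.tsum_mul_left]
        rw [Summable.tsum_finsetSum fun _ _ => ENNReal.summable]
    _ ≤ ∑' T, R T * ENNReal.ofReal β := by
        refine ENNReal.tsum_le_tsum fun T => ?_
        have heq : ∑ x, ENNReal.ofReal (W x) *
            {D : DecisionTree _ _ | D.output (flatten x) ∈
              listDecoding n ℓ fun i => f (x i)}.indicator R T =
            R T * ENNReal.ofReal (listWeight f ℓ (fun _ => μ) T) := by
          rw [listWeight, ENNReal.ofReal_sum_of_nonneg, Finset.mul_sum]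
          · refine Finset.sum_congr rfl fun x _ => ?_
            by_cases hx : T.output (flatten x) ∈ listDecoding n ℓ fun i => f (x i) <;>
              simp [Set.indicator, hx, hW, mul_comm]
          · intro x _
            exact mul_nonneg (hW₀ x) (by split <;> norm_num)
        rw [heq]
        by_cases hT : T ∈ R.support
        · exact mul_le_mul_right (ENNReal.ofReal_le_ofReal (h T hT)) _
        · simp [(PMF.apply_eq_zero_iff R T).2 hT]
    _ = ENNReal.ofReal β := by rw [ENNReal.tsum_mul_right, R.tsum_coe, one_mul]

lemma listWeight_truncate_eq {m n ℓ : ℕ} {X : Set (Fin m → Bool)} [Fintype X] {f : X → Bool}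
    {w : Fin n → X → ℝ} {T : DecisionTree (Fin n × Fin m) (Finset (Fin n → Bool))} {q : ℕ}
    (hT : ∀ x ∈ powDomain X n, T.cost x ≤ q) :
    listWeight f ℓ w (T.truncate ∅ q) = listWeight f ℓ w T := by
  unfold listWeight
  refine Finset.sum_congr rfl fun x _ => ?_
  rw [DecisionTree.output_truncate _ _ _ _ (hT _ (flatten_mem_powDomain x))]

lemma mul_le_of_listDecoding {m n ℓ q r : ℕ} {X : Set (Fin m → Bool)} {f : X → Bool} {γ : ℝ}
    (hℓ₁ : 1 ≤ ℓ) (hℓ : ℓ ≤ n) (hγ : 9 / 10 ≤ γ) (hr : 1 ≤ r)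
    (hf : (r : ℕ∞) ≤ randQueryComplexity (2 / 3) (functionRel f))
    {R : RandAlg (Fin n × Fin m) (Finset (Fin n → Bool))}
    (hR : ∀ x : powDomain X n,
      ENNReal.ofReal (γ ^ ℓ) ≤ R.prob x (listDecoding n ℓ (directProduct f n x)))
    (hq : R.worstCost (powDomain X n) ≤ q) : (ℓ : ℝ) * r ≤ 1000 * q := by
  have : Fintype X := Fintype.ofFinite X
  have : Nonempty (DecisionTree (Fin m) ℝ) := ⟨.leaf 0⟩
  have hr₀ : (0 : ℝ) < r := by exact_mod_cast hr
  have hlam : (0 : ℝ) < 81 / r := by positivity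
  rcases exists_distribution_or_mixture fun (D : DecisionTree (Fin m) ℝ) (x : X) =>
    score (D.output x) (f x) - 81 / r * D.cost x with ⟨μ, hμ₀, hμ, hadv⟩ | ⟨v, hv, hpos⟩
  swap
  · exfalso
    -- The bound `r - 1` makes λ (B + 1) exactly 81 and contradicts `hf`.
    have h1 := randQueryComplexity_le_of_score f hlam (r - 1)
      (by rw [Nat.cast_sub hr]; push_cast; rw [sub_add_cancel, div_mul_cancel₀ _ hr₀.ne'])
      hv hpos
    have h2 := hf.trans h1
    rw [Nat.cast_le] at h2
    omega
  have hpot : potential f (81 / r) μ ≤ 1 := by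
    have : maxAdvantage f (81 / r) μ ≤ 0 := ciSup_le hadv
    rw [potential, fiberWeight_add, hμ]
    linarith
  have hβ : ∀ T ∈ R.support, listWeight f ℓ (fun _ => μ) T ≤
      √((1 / 2) ^ ℓ) * (1 + 2 * (81 / r)) ^ q := by
    intro T hT
    rw [← listWeight_truncate_eq fun x hx => by
      have : (T.cost x : ℕ∞) ≤ q := le_trans (le_iSup₂_of_le T hT
        (le_iSup₂_of_le (f := fun x (_ : x ∈ powDomain X n) => (T.cost x : ℕ∞)) x hx le_rfl)) hq
      exact_mod_cast this]
    refine (listWeight_truncate_le hℓ hlam.le (fun _ => hμ₀) T q).trans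
      (mul_le_of_le_one_right (by positivity) ?_)
    exact Finset.prod_le_one (fun _ _ => potential_nonneg hμ₀ hlam.le) fun _ _ => hpot
  have hmain := le_of_listWeight_le (by positivity) hμ₀ hμ hR hβ
  by_contra! hlt
  have hsq : (γ ^ ℓ) ^ 2 ≤ (1 / 2) ^ ℓ * ((1 + 2 * (81 / r)) ^ q) ^ 2 := by
    have := pow_le_pow_left₀ (pow_nonneg (by linarith) ℓ) hmain 2
    rwa [mul_pow, Real.sq_sqrt (by positivity)] at this
  -- Here 2 · 2 · 81 = 324 and 324/1000 < 1/3, while e^(1/3) ≤ 3/2.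
  have hexp : ((1 + 2 * (81 / r) : ℝ) ^ q) ^ 2 ≤ (3 / 2) ^ ℓ :=
    calc ((1 + 2 * (81 / r) : ℝ) ^ q) ^ 2 ≤ (Real.exp (2 * (81 / r)) ^ q) ^ 2 := by
          gcongr
          rw [add_comm]; exact Real.add_one_le_exp _
      _ = Real.exp (324 * (q / r)) := by
          rw [← Real.exp_nat_mul, ← Real.exp_nat_mul]; congr 1; push_cast; ring
      _ ≤ Real.exp (ℓ * (1 / 3)) := by
          have : (q : ℝ) / r ≤ ℓ / 1000 := by
            rw [div_le_div_iff₀ hr₀ (by norm_num)]; linarith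
          refine Real.exp_le_exp.2 ?_
          have : (0 : ℝ) ≤ ℓ := Nat.cast_nonneg _
          linarith
      _ = Real.exp (1 / 3) ^ ℓ := Real.exp_nat_mul _ _
      _ ≤ (3 / 2) ^ ℓ := by
          gcongr
          have h1 := Real.one_sub_le_exp_neg (1 / 3)
          have h2 : Real.exp (1 / 3) * Real.exp (-(1 / 3)) = 1 := by
            rw [← Real.exp_add]; simp
          nlinarith [Real.exp_pos (1 / 3)]
  have hlow : (81 / 100 : ℝ) ^ ℓ ≤ (γ ^ ℓ) ^ 2 := by
    rw [pow_right_comm]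
    gcongr
    nlinarith
  have hup : (1 / 2 : ℝ) ^ ℓ * ((1 + 2 * (81 / r)) ^ q) ^ 2 ≤ (3 / 4) ^ ℓ := by
    calc _ ≤ (1 / 2 : ℝ) ^ ℓ * (3 / 2) ^ ℓ := by gcongr
      _ = _ := by rw [← mul_pow]; norm_num
  -- The contradiction compares (9/10)² = 81/100 with (1/2)(3/2) = 3/4; strictness needs ℓ ≥ 1.
  have hstrict : (3 / 4 : ℝ) ^ ℓ < (81 / 100) ^ ℓ :=
    pow_lt_pow_left₀ (by norm_num) (by norm_num) (by omega)
  linarith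

theorem theorem2 :
    ∃ c κ : ℝ, 1 / 2 < c ∧ c < 1 ∧ 0 < κ ∧
      ∀ (m : ℕ) (X : Set (Fin m → Bool)) (f : X → Bool) (n ℓ : ℕ) (γ : ℝ),
        1 ≤ n → 1 ≤ ℓ → ℓ ≤ n → c ≤ γ → γ < 1 →
          ENNReal.ofReal κ * (ℓ : ℝ≥0∞) * (randQueryComplexity (2 / 3) (functionRel f) : ℝ≥0∞) ≤
            (randQueryComplexity (γ ^ ℓ)
              (fun x => listDecoding n ℓ (directProduct f n x)) : ℝ≥0∞) := by
  refine ⟨9 / 10, 1 / 1000, by norm_num, by norm_num, by norm_num, ?_⟩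
  intro m X f n ℓ γ _ hℓ₁ hℓ hγ _
  generalize hQ : randQueryComplexity (γ ^ ℓ)
    (fun x => listDecoding n ℓ (directProduct f n x)) = Q
  induction Q using ENat.recTopCoe with
  | top => simp
  | coe q =>
    -- An infimum below `q + 1` in `ℕ∞` yields an algorithm of cost at most `q`.
    obtain ⟨R, hR⟩ := iInf_lt_iff.1 (hQ.trans_lt (ENat.natCast_lt_natCast.2 q.lt_succ_self))
    obtain ⟨hR, hq⟩ := iInf_lt_iff.1 hR
    have hq' : R.worstCost (powDomain X n) ≤ q := by
      rw [Nat.cast_succ] at hq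
      exact Order.le_of_lt_add_one hq
    have key := fun (r : ℕ) (hr : 1 ≤ r) hf =>
      mul_le_of_listDecoding (r := r) (f := f) hℓ₁ hℓ hγ hr hf hR hq'
    generalize randQueryComplexity (2 / 3) (functionRel f) = r at key
    induction r using ENat.recTopCoe with
    | top =>
      -- If R(f) is infinite, every `r` is allowed, and this one already violates ℓ r ≤ 1000 q.
      have h1 := key (1000 * q + 1) (by omega) le_top
      have h2 : (1 : ℝ) ≤ ℓ := by exact_mod_cast hℓ₁
      push_cast at h1
      nlinarith [(Nat.cast_nonneg q : (0 : ℝ) ≤ q)]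
    | coe r =>
      rcases r.eq_zero_or_pos with rfl | hr
      · simp
      · have h1 := key r hr le_rfl
        simp only [ENat.toENNReal_coe]
        rw [← ENNReal.ofReal_natCast ℓ, ← ENNReal.ofReal_natCast r, ← ENNReal.ofReal_natCast q,
          ← ENNReal.ofReal_mul (by norm_num), ← ENNReal.ofReal_mul (by positivity)]
        exact ENNReal.ofReal_le_ofReal (by linarith)
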